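/- Let $f:\mathbb{R}\to\mathbb{R}$ be locally Lipschitz continuous with $f(0)=0$ and $yf(y)>0$ for all $y\neq 0$. Let $g:[0,\infty)\to\mathbb{R}$ be continuous with $g(t)>0$ for $t>0$, let $\xi>0$, and let $x$ be the unique continuous solution on $[0,\infty)$ of $$x'(t)=-f(x(t))+g(t),\quad t>0;\qquad x(0)=\xi .$$ Put $F(y)=\int_y^1 \frac{du}{f(u)}$ for $y>0$. This is a strictly decreasing function with $F(0+)=\infty$; let $F^{-1}$ be its inverse, which is defined in particular on $[0,\infty)$. A measurable $h:(0,\infty)\to(0,\infty)$ is in $\mathrm{RV}_0(\beta)$ if $\lim_{y\to0^+}h(\lambda y)/h(y)=\lambda^\beta$ for all $\lambda>0$. A measurable $h:[0,\infty)\to(0,\infty)$ is in $\mathrm{RV}_\infty(\alpha)$ if $\lim_{t\to\infty}h(\lambda t)/h(t)=\lambda^\alpha$ for all $\lambda>0$. Suppose that - $f\in \mathrm{RV}_0(\beta)$ for some $\beta>1$, or $f\circ F^{-1}\in\mathrm{RV}_\infty(-1)$; - there are $\delta>0$ and a function $\phi$, increasing (not necessarily strictly) on $(0,\delta)$, with $\lim_{y\to0^+}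 f(y)/\phi(y)=1$; - $x(t)\to0$ as $t\to\infty$; - $\lim_{t\to\infty} \dfrac{g(t)}{f(F^{-1}(t))}=L$ for some $L\in[0,\infty]$. Then: (i) If $L=0$, then $\lim_{t\to\infty}F(x(t))/t=1$. (ii) If $L\in(0,\infty)$, then $\lim_{t\to\infty}F(x(t))/t=\Lambda_*(L)\in(0,1)$, where (I) if $f\in\mathrm{RV}_0(\beta)$ with $\beta>1$, $\Lambda_*(L)$ is the unique $\Lambda>0$ with $(1-\Lambda)\Lambda^{-\beta/(\beta-1)}=L$ (it exists and lies in $(0,1)$); and (II) if $f\circ F^{-1}\in\mathrm{RV}_\infty(-1)$, $\Lambda_*(L)=1/(1+L)$. (iii) If $L=\infty$, then $\lim_{t\to\infty}F(x(t))/t=0$. -/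

import Mathlib

open Filter Topology Set

noncomputable section

/-- Regular variation at `0` with index `β`, for a function on `(0, ∞)`
(values of `f` outside `(0, ∞)` play no role). -/
def RegVaryAtZero (f : ℝ → ℝ) (β : ℝ) : Prop :=
  Measurable ((Ioi (0 : ℝ)).domRestrict f) ∧ (∀ x > 0, 0 < f x) ∧
    ∀ c > 0, Tendsto (fun x => f (c * x) / f x) (𝓝[>] 0) (𝓝 (c ^ β))

/-- Regular variation at infinity with index `α`, for a function on `[0, ∞)`
(values of `h` outside `[0, ∞)` play no role). -/
def RegVaryAtInfty (h : ℝ → ℝ) (α : ℝ) : Prop :=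
  Measurable ((Ici (0 : ℝ)).domRestrict h) ∧ (∀ t ≥ 0, 0 < h t) ∧
    ∀ c > 0, Tendsto (fun t => h (c * t) / h t) atTop (𝓝 (c ^ α))

/-- `F(x) = ∫_x^1 du / f(u)`, for `x > 0`. -/
def decayF (f : ℝ → ℝ) (x : ℝ) : ℝ := ∫ u in x..1, 1 / f u

/-- The inverse `F⁻¹` of `F : (0, ∞) → ℝ`. For `f` locally Lipschitz with `f 0 = 0` and
`x * f x > 0` for `x ≠ 0`, `F` is strictly decreasing and `F(0+) = ∞`, so every `t ≥ 0` is
attained on `(0, ∞)` and `decayFInv f t` is its unique preimage there. -/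
def decayFInv (f : ℝ → ℝ) : ℝ → ℝ := Function.invFunOn (decayF f) (Ioi 0)

/-- `f` is asymptotic, at `0+`, to a function that is increasing on some `(0, δ)`. -/
def AsympIncreasingAtZero (f : ℝ → ℝ) : Prop :=
  ∃ (φ : ℝ → ℝ) (δ : ℝ), 0 < δ ∧ MonotoneOn φ (Ioo 0 δ) ∧
    Tendsto (fun x => f x / φ x) (𝓝[>] 0) (𝓝 1)

/-- `x` is a continuous solution on `[0, ∞)` of `x' = -f(x) + g` for `t > 0`, `x(0) = ξ`. -/
structure IsPerturbedSolution (f g : ℝ → ℝ) (ξ : ℝ) (x : ℝ → ℝ) : Prop where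
  continuousOn : ContinuousOn x (Ici 0)
  init : x 0 = ξ
  hasDerivAt : ∀ t > 0, HasDerivAt x (-f (x t) + g t) t

end

/-!
Put `h = f ∘ F⁻¹`. The function `y = F ∘ x` solves `y' = 1 - g / h(y)`, and `h` varies regularly
at infinity with index `-γ`, where `γ = 1` in case (II) and `γ = β / (β - 1)` in case (I), by
L'Hôpital's rule for `F(c z) / F(z)`. If `y(t) ~ c t`, then `g(t) / h(y(t)) → L c ^ γ`, so `y'` has
the limit `1 - L c ^ γ`, which has to be `c` itself: this is the equation for `Λ`.

Conversely, `1 - L c ^ γ < c` when `c > Λ`. Since `f` is asymptotically increasing, `h` is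
decreasing up to a factor close to `1`, so that `y' - c` is negative and bounded away from `0` as
long as `y` is above the line `c t`. Hence `y` falls below this line and stays there. In the same
way `y` stays above the line `c t` when `c < Λ`.
-/

section DerivativeBounds

variable {p q p' q' : ℝ → ℝ} {a l m b η : ℝ}

lemma exists_eventually_le_nhdsGT_of_deriv_nonneg (hp : ∀ᶠ y in 𝓝[>] a, HasDerivAt p (p' y) y)
    (hp' : ∀ᶠ y in 𝓝[>] a, 0 ≤ p' y) : ∃ C, ∀ᶠ y in 𝓝[>] a, p y ≤ C := by
  obtain ⟨r, har, hr⟩ := mem_nhdsGT_iff_exists_Ioo_subset.1 (hp.and hp')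
  have hmono : MonotoneOn p (Ioo a r) := by
    refine monotoneOn_of_hasDerivWithinAt_nonneg (f' := p') (convex_Ioo a r)
      (fun y hy => (hr hy).1.continuousAt.continuousWithinAt) ?_ ?_ <;> rw [interior_Ioo]
    · exact fun y hy => (hr hy).1.hasDerivWithinAt
    · exact fun y hy => (hr hy).2
  obtain ⟨c, hac, hcr⟩ := exists_between (mem_Ioi.1 har)
  refine ⟨p c, ?_⟩
  filter_upwards [Ioo_mem_nhdsGT hac] with y hy
  exact hmono ⟨hy.1, hy.2.trans hcr⟩ ⟨hac, hcr⟩ hy.2.le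

lemma eventually_div_lt_nhdsGT_of_deriv_div_le (hp : ∀ᶠ y in 𝓝[>] a, HasDerivAt p (p' y) y)
    (hq : ∀ᶠ y in 𝓝[>] a, HasDerivAt q (q' y) y) (hq' : ∀ᶠ y in 𝓝[>] a, q' y < 0)
    (hq_top : Tendsto q (𝓝[>] a) atTop) (hm : ∀ᶠ y in 𝓝[>] a, p' y / q' y ≤ m) (hmb : m < b) :
    ∀ᶠ y in 𝓝[>] a, p y / q y < b := by
  obtain ⟨C, hC⟩ : ∃ C, ∀ᶠ y in 𝓝[>] a, p y - m * q y ≤ C := by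
    refine exists_eventually_le_nhdsGT_of_deriv_nonneg (p' := fun y => p' y - m * q' y) ?_ ?_
    · filter_upwards [hp, hq] with y hpy hqy using hpy.sub (hqy.const_mul m)
    · filter_upwards [hq', hm] with y hq'y hmy
      exact sub_nonneg.2 ((div_le_iff_of_neg hq'y).1 hmy)
  filter_upwards [hC, hq_top.eventually_gt_atTop 0, hq_top.eventually_gt_atTop (C / (b - m))]
    with y hCy hqy hCq
  rw [div_lt_iff₀ (sub_pos.2 hmb)] at hCq
  rw [div_lt_iff₀ hqy]
  linarith

lemma lhopital_atTop_nhdsGT (hp : ∀ᶠ y in 𝓝[>] a, HasDerivAt p (p' y) y)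
    (hq : ∀ᶠ y in 𝓝[>] a, HasDerivAt q (q' y) y) (hq' : ∀ᶠ y in 𝓝[>] a, q' y < 0)
    (hq_top : Tendsto q (𝓝[>] a) atTop)
    (h : Tendsto (fun y => p' y / q' y) (𝓝[>] a) (𝓝 l)) :
    Tendsto (fun y => p y / q y) (𝓝[>] a) (𝓝 l) := by
  refine tendsto_order.2 ⟨fun b hb => ?_, fun b hb => ?_⟩
  · obtain ⟨m, hbm, hml⟩ := exists_between hb
    have hm : ∀ᶠ y in 𝓝[>] a, -p' y / q' y ≤ -m := by
      filter_upwards [h.eventually_const_le hml] with y hy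
      rwa [neg_div, neg_le_neg_iff]
    filter_upwards [eventually_div_lt_nhdsGT_of_deriv_div_le (p := fun y => -p y)
      (hp.mono fun y hy => hy.neg) hq hq' hq_top hm (neg_lt_neg hbm)] with y hy
    rwa [neg_div, neg_lt_neg_iff] at hy
  · obtain ⟨m, hlm, hmb⟩ := exists_between hb
    exact eventually_div_lt_nhdsGT_of_deriv_div_le hp hq hq' hq_top (h.eventually_le_const hlm) hmb

lemma tendsto_atBot_of_deriv_le_neg (hη : 0 < η) (hp : ∀ᶠ t in atTop, HasDerivAt p (p' t) t)
    (hp' : ∀ᶠ t in atTop, p' t ≤ -η) : Tendsto p atTop atBot := by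
  obtain ⟨T, hT⟩ := eventually_atTop.1 (hp.and hp')
  have hline : ∀ᶠ t in atTop, p t ≤ p T + -η * (t - T) := by
    filter_upwards [eventually_ge_atTop T] with t ht
    rw [← sub_le_iff_le_add']
    refine (convex_Ici T).image_sub_le_mul_sub_of_deriv_le
      (fun s hs => (hT s hs).1.continuousAt.continuousWithinAt)
      (fun s hs => (hT s (interior_subset hs)).1.differentiableAt.differentiableWithinAt)
      (fun s hs => ?_) T self_mem_Ici t ht ht
    obtain ⟨hd, hle⟩ := hT s (interior_subset hs)
    rwa [hd.deriv]
  refine tendsto_atBot_mono' _ hline (tendsto_atBot_add_const_left _ _ ?_)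
  exact (tendsto_atTop_add_const_right _ (-T) tendsto_id).const_mul_atTop_of_neg
    (neg_neg_of_pos hη)

lemma eventually_nonpos_of_deriv_le_neg (hη : 0 < η) (hp : ∀ᶠ t in atTop, HasDerivAt p (p' t) t)
    (hp' : ∀ᶠ t in atTop, 0 ≤ p t → p' t ≤ -η) : ∀ᶠ t in atTop, p t ≤ 0 := by
  obtain ⟨T, hT⟩ := eventually_atTop.1 (hp.and hp')
  have hfreq : ∃ᶠ t in atTop, p t ≤ 0 := fun hpos => by
    have hbot : Tendsto p atTop atBot := tendsto_atBot_of_deriv_le_neg hη hp <| by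
      filter_upwards [hp', hpos] with t ht hpt using ht (not_le.1 hpt).le
    obtain ⟨t, hle, hgt⟩ := ((hbot.eventually_le_atBot 0).and hpos).exists
    exact hgt hle
  obtain ⟨t₀, hTt₀, hpt₀⟩ := (frequently_atTop.1 hfreq) T
  filter_upwards [eventually_ge_atTop t₀] with t ht
  exact image_le_of_deriv_right_lt_deriv_boundary (B := fun _ => 0) (B' := fun _ => 0)
    (fun s hs => (hT s (hTt₀.trans hs.1)).1.continuousAt.continuousWithinAt)
    (fun s hs => (hT s (hTt₀.trans hs.1)).1.hasDerivWithinAt) hpt₀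
    (fun s => hasDerivAt_const s 0)
    (fun s hs hps => ((hT s (hTt₀.trans hs.1)).2 hps.ge).trans_lt (neg_neg_of_pos hη))
    (right_mem_Icc.2 ht)

end DerivativeBounds

lemma tendsto_div_of_eventually_between_lines {y : ℝ → ℝ} {Λ : ℝ} (hy : ∀ᶠ t in atTop, 0 ≤ y t)
    (hlower : ∀ c, 0 < c → c < Λ → ∀ᶠ t in atTop, c * t ≤ y t)
    (hupper : ∀ c, Λ < c → ∀ᶠ t in atTop, y t ≤ c * t) :
    Tendsto (fun t => y t / t) atTop (𝓝 Λ) := by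
  refine tendsto_order.2 ⟨fun a ha => ?_, fun a ha => ?_⟩
  · rcases lt_or_ge a 0 with ha0 | ha0
    · filter_upwards [hy, eventually_ge_atTop 0] with t hyt ht
      exact ha0.trans_le (div_nonneg hyt ht)
    · obtain ⟨c, hac, hcΛ⟩ := exists_between ha
      filter_upwards [hlower c (ha0.trans_lt hac) hcΛ, eventually_gt_atTop 0] with t hct ht
      exact hac.trans_le ((le_div_iff₀ ht).2 hct)
  · obtain ⟨c, hΛc, hca⟩ := exists_between ha
    filter_upwards [hupper c hΛc, eventually_gt_atTop 0] with t hct ht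
    exact ((div_le_iff₀ ht).2 hct).trans_lt hca

lemma exists_first_zero {x : ℝ → ℝ} {a b : ℝ} (hab : a ≤ b) (hx : ContinuousOn x (Icc a b))
    (ha : 0 < x a) (hb : x b ≤ 0) : ∃ s ∈ Ioc a b, x s = 0 ∧ ∀ t ∈ Ico a s, 0 < x t := by
  have hcompact : IsCompact (Icc a b ∩ x ⁻¹' {0}) :=
    isCompact_Icc.of_isClosed_subset
      (hx.preimage_isClosed_of_isClosed isClosed_Icc isClosed_singleton) inter_subset_left
  have hzero : ∀ t ∈ Icc a b, x t ≤ 0 → ∃ u ∈ Icc a t, x u = 0 := fun t ht hxt =>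
    intermediate_value_Icc' ht.1 (hx.mono (Icc_subset_Icc_right ht.2)) ⟨hxt, ha.le⟩
  obtain ⟨u, hu, hxu⟩ := hzero b (right_mem_Icc.2 hab) hb
  obtain ⟨s, ⟨hs, hxs⟩, hmin⟩ := hcompact.exists_isLeast ⟨u, hu, hxu⟩
  refine ⟨s, ⟨hs.1.lt_of_ne fun h => ha.ne' (h ▸ hxs), hs.2⟩, hxs, fun t ht => ?_⟩
  by_contra! hxt
  obtain ⟨u, hu, hxu⟩ := hzero t ⟨ht.1, ht.2.le.trans hs.2⟩ hxt
  exact (hmin ⟨⟨hu.1, hu.2.trans (ht.2.le.trans hs.2)⟩, hxu⟩).not_gt (hu.2.trans_lt ht.2)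

/-- Osgood's condition for the decay equation `z' = -f z` on `(0, ∞)`: since `decayF f y` is the
time needed to decay from `1` to `y`, the last field says that `0` is not reached in finite time.
Nothing is required of `f` outside `(0, ∞)`. -/
structure IsOsgood (f : ℝ → ℝ) : Prop where
  continuousOn : ContinuousOn f (Ioi 0)
  pos : ∀ y > 0, 0 < f y
  tendsto_decayF : Tendsto (decayF f) (𝓝[>] 0) atTop

section DecayF

variable {f : ℝ → ℝ}

lemma hasDerivAt_decayF (hf : ContinuousOn f (Ioi 0)) (hpos : ∀ y > 0, 0 < f y) {y : ℝ}
    (hy : 0 < y) : HasDerivAt (decayF f) (-(1 / f y)) y := by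
  have hcont : ContinuousOn (fun u => 1 / f u) (Ioi 0) :=
    continuousOn_const.div hf fun u hu => (hpos u hu).ne'
  refine intervalIntegral.integral_hasDerivAt_left ?_ ?_ (hcont.continuousAt (Ioi_mem_nhds hy))
  · exact (hcont.mono fun u hu => (lt_min hy one_pos).trans_le hu.1).intervalIntegrable
  · exact hcont.stronglyMeasurableAtFilter isOpen_Ioi y hy

lemma tendsto_decayF_of_le_mul (hf : ContinuousOn f (Ioi 0)) (hpos : ∀ y > 0, 0 < f y) {K : ℝ}
    (hK : 0 < K) (hle : ∀ᶠ y in 𝓝[>] 0, f y ≤ K * y) : Tendsto (decayF f) (𝓝[>] 0) atTop := by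
  obtain ⟨C, hC⟩ : ∃ C, ∀ᶠ y in 𝓝[>] 0, -decayF f y + -(K⁻¹ * Real.log y) ≤ C := by
    refine exists_eventually_le_nhdsGT_of_deriv_nonneg
      (p' := fun y => -(-(1 / f y)) + -(K⁻¹ * y⁻¹)) ?_ ?_
    · filter_upwards [self_mem_nhdsWithin] with y (hy : 0 < y)
      exact (hasDerivAt_decayF hf hpos hy).neg.add
        ((Real.hasDerivAt_log hy.ne').const_mul K⁻¹).neg
    · filter_upwards [hle, self_mem_nhdsWithin] with y hley (hy : 0 < y)
      rw [neg_neg, ← sub_eq_add_neg, sub_nonneg, ← mul_inv, ← one_div]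
      exact one_div_le_one_div_of_le (hpos y hy) hley
  have hlog : Tendsto (fun y => -C + K⁻¹ * -Real.log y) (𝓝[>] 0) atTop :=
    tendsto_atTop_add_const_left _ _ <|
      (tendsto_neg_atBot_atTop.comp Real.tendsto_log_nhdsGT_zero).const_mul_atTop (inv_pos.2 hK)
  refine tendsto_atTop_mono' _ ?_ hlog
  filter_upwards [hC] with y hy
  linarith

lemma exists_eventually_le_mul_of_locallyLipschitz (hf : LocallyLipschitz f) (hf_zero : f 0 = 0) :
    ∃ K > 0, ∀ᶠ y in 𝓝[>] 0, f y ≤ K * y := by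
  obtain ⟨K, s, hs, hK⟩ := hf 0
  refine ⟨K + 1, by positivity, ?_⟩
  filter_upwards [mem_nhdsWithin_of_mem_nhds hs, self_mem_nhdsWithin] with y hys (hy : 0 < y)
  have hdist := hK.dist_le_mul y hys 0 (mem_of_mem_nhds hs)
  rw [hf_zero, dist_zero_right, dist_zero_right, Real.norm_of_nonneg hy.le] at hdist
  linarith [Real.le_norm_self (f y)]

lemma IsOsgood.of_locallyLipschitz (hf : LocallyLipschitz f) (hf_zero : f 0 = 0)
    (hpos : ∀ y > 0, 0 < f y) : IsOsgood f := by
  obtain ⟨K, hK, hle⟩ := exists_eventually_le_mul_of_locallyLipschitz hf hf_zero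
  have hcont := hf.continuous.continuousOn (s := Ioi 0)
  exact ⟨hcont, hpos, tendsto_decayF_of_le_mul hcont hpos hK hle⟩

namespace IsOsgood

variable {y t : ℝ}

lemma hasDerivAt_decayF (hf : IsOsgood f) (hy : 0 < y) :
    HasDerivAt (decayF f) (-(1 / f y)) y :=
  _root_.hasDerivAt_decayF hf.continuousOn hf.pos hy

lemma strictAntiOn_decayF (hf : IsOsgood f) : StrictAntiOn (decayF f) (Ioi 0) := by
  refine strictAntiOn_of_deriv_neg (convex_Ioi 0)
    (fun y hy => (hf.hasDerivAt_decayF hy).continuousAt.continuousWithinAt) fun y hy => ?_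
  rw [(hf.hasDerivAt_decayF (interior_subset hy)).deriv]
  exact neg_neg_of_pos (one_div_pos.2 (hf.pos y (interior_subset hy)))

lemma exists_decayF_eq (hf : IsOsgood f) (ht : 0 ≤ t) : ∃ y ∈ Ioi (0 : ℝ), decayF f y = t := by
  obtain ⟨a, hta, ha⟩ :=
    ((hf.tendsto_decayF.eventually_ge_atTop t).and self_mem_nhdsWithin).exists
  have hcont : ContinuousOn (decayF f) (Ioi 0) :=
    fun y hy => (hf.hasDerivAt_decayF hy).continuousAt.continuousWithinAt
  have hone : decayF f 1 = 0 := intervalIntegral.integral_same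
  exact isPreconnected_Ioi.intermediate_value (mem_Ioi.2 one_pos) ha hcont ⟨hone ▸ ht, hta⟩

lemma decayFInv_pos (hf : IsOsgood f) (ht : 0 ≤ t) : 0 < decayFInv f t :=
  Function.invFunOn_mem (hf.exists_decayF_eq ht)

lemma decayF_decayFInv (hf : IsOsgood f) (ht : 0 ≤ t) : decayF f (decayFInv f t) = t :=
  Function.invFunOn_eq (hf.exists_decayF_eq ht)

lemma decayFInv_decayF (hf : IsOsgood f) (hy : 0 < y) : decayFInv f (decayF f y) = y :=
  hf.strictAntiOn_decayF.injOn.leftInvOn_invFunOn hy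

lemma lt_decayFInv_iff (hf : IsOsgood f) (hy : 0 < y) (ht : 0 ≤ t) :
    y < decayFInv f t ↔ t < decayF f y := by
  rw [← hf.strictAntiOn_decayF.lt_iff_gt (hf.decayFInv_pos ht) hy, hf.decayF_decayFInv ht]

lemma decayFInv_lt_iff (hf : IsOsgood f) (hy : 0 < y) (ht : 0 ≤ t) :
    decayFInv f t < y ↔ decayF f y < t := by
  rw [← hf.strictAntiOn_decayF.lt_iff_gt hy (hf.decayFInv_pos ht), hf.decayF_decayFInv ht]

lemma antitoneOn_decayFInv (hf : IsOsgood f) : AntitoneOn (decayFInv f) (Ici 0) := by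
  intro s hs t ht hst
  rwa [← not_lt, hf.lt_decayFInv_iff (hf.decayFInv_pos hs) ht, hf.decayF_decayFInv hs, not_lt]

lemma tendsto_decayFInv (hf : IsOsgood f) : Tendsto (decayFInv f) atTop (𝓝[>] 0) := by
  have hpos : ∀ᶠ t in atTop, 0 < decayFInv f t :=
    (eventually_ge_atTop 0).mono fun t ht => hf.decayFInv_pos ht
  refine tendsto_nhdsWithin_iff.2 ⟨tendsto_order.2 ⟨fun a ha => ?_, fun a ha => ?_⟩, hpos⟩
  · exact hpos.mono fun t ht => ha.trans ht
  · filter_upwards [eventually_ge_atTop 0, eventually_gt_atTop (decayF f a)] with t ht hat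
    exact (hf.decayFInv_lt_iff ha ht).2 hat

lemma measurable_comp_decayFInv (hf : IsOsgood f) :
    Measurable ((Ici (0 : ℝ)).domRestrict (f ∘ decayFInv f)) := by
  have hinv : Measurable fun t : Ici (0 : ℝ) => decayFInv f t :=
    Antitone.measurable fun s t hst => hf.antitoneOn_decayFInv s.2 t.2 hst
  exact hf.continuousOn.domRestrict.measurable.comp
    (hinv.subtype_mk (h := fun t => hf.decayFInv_pos t.2))

end IsOsgood

end DecayF

section AsymptoticMonotonicity

/-- A function that is decreasing near `∞` up to a factor arbitrarily close to `1`. This is the form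
which `AsympIncreasingAtZero f` takes for `f ∘ decayFInv f`. -/
def AlmostAntitoneAtTop (h : ℝ → ℝ) : Prop :=
  ∀ K > 1, ∀ᶠ s in atTop, ∀ t ≥ s, h t ≤ K * h s

variable {f : ℝ → ℝ}

lemma AsympIncreasingAtZero.eventually_forall_le_mul (hf : AsympIncreasingAtZero f)
    (hpos : ∀ᶠ y in 𝓝[>] 0, 0 < f y) {K : ℝ} (hK : 1 < K) :
    ∀ᶠ v in 𝓝[>] 0, ∀ u ∈ Ioc 0 v, f u ≤ K * f v := by
  obtain ⟨φ, δ, hδ, hφ_mono, hφ_lim⟩ := hf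
  obtain ⟨a, ha1, haK⟩ := exists_between hK
  have ha0 : 0 < a := one_pos.trans ha1
  have hbounds : ∀ᶠ y in 𝓝[>] 0, 0 < φ y ∧ f y ≤ a * φ y ∧ a * φ y ≤ K * f y := by
    filter_upwards [hpos, hφ_lim.eventually_lt_const ha1,
      hφ_lim.eventually_const_lt ((div_lt_one (ha0.trans haK)).2 haK)] with y hfy hlt hgt
    have hφy : 0 < φ y :=
      (div_pos_iff_of_pos_left hfy).1 ((div_pos ha0 (ha0.trans haK)).trans hgt)
    refine ⟨hφy, ((div_lt_iff₀ hφy).1 hlt).le, ?_⟩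
    rw [div_lt_div_iff₀ (ha0.trans haK) hφy] at hgt
    linarith
  obtain ⟨r, hr0, hr⟩ := mem_nhdsGT_iff_exists_Ioo_subset.1 hbounds
  filter_upwards [Ioo_mem_nhdsGT (lt_min hδ hr0)] with v ⟨hv0, hv⟩ u ⟨hu0, huv⟩
  obtain ⟨hvδ, hvr⟩ := lt_min_iff.1 hv
  calc f u ≤ a * φ u := (hr ⟨hu0, huv.trans_lt hvr⟩).2.1
    _ ≤ a * φ v := by gcongr; exact hφ_mono ⟨hu0, huv.trans_lt hvδ⟩ ⟨hv0, hvδ⟩ huv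
    _ ≤ K * f v := (hr ⟨hv0, hvr⟩).2.2

lemma AsympIncreasingAtZero.almostAntitoneAtTop_comp_decayFInv (hf : AsympIncreasingAtZero f)
    (hO : IsOsgood f) : AlmostAntitoneAtTop (f ∘ decayFInv f) := by
  intro K hK
  have hpos : ∀ᶠ y in 𝓝[>] 0, 0 < f y := by filter_upwards [self_mem_nhdsWithin] using hO.pos
  filter_upwards [hO.tendsto_decayFInv.eventually (hf.eventually_forall_le_mul hpos hK),
    eventually_ge_atTop 0] with s hle hs t hst
  exact hle _ ⟨hO.decayFInv_pos (hs.trans hst), hO.antitoneOn_decayFInv hs (hs.trans hst) hst⟩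

end AsymptoticMonotonicity

section RegularVariation

variable {f : ℝ → ℝ} {β : ℝ}

lemma RegVaryAtZero.tendsto_decayF_mul_div (hf : RegVaryAtZero f β) (hO : IsOsgood f) {c : ℝ}
    (hc : 0 < c) :
    Tendsto (fun y => decayF f (c * y) / decayF f y) (𝓝[>] 0) (𝓝 (c ^ (1 - β))) := by
  have hmem : ∀ᶠ y : ℝ in 𝓝[>] 0, 0 < y := self_mem_nhdsWithin
  refine lhopital_atTop_nhdsGT (p' := fun y => -(1 / f (c * y)) * (c * 1))
    (hmem.mono fun y hy => ?_) (hmem.mono fun y hy => hO.hasDerivAt_decayF hy)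
    (hmem.mono fun y hy => neg_neg_of_pos (one_div_pos.2 (hO.pos y hy))) hO.tendsto_decayF ?_
  · exact (hO.hasDerivAt_decayF (mul_pos hc hy)).comp y ((hasDerivAt_id y).const_mul c)
  · have hlim := ((hf.2.2 c hc).inv₀ (Real.rpow_pos_of_pos hc β).ne').const_mul c
    have hexp : c * (c ^ β)⁻¹ = c ^ (1 - β) := by
      rw [Real.rpow_sub hc, Real.rpow_one, div_eq_mul_inv]
    rw [hexp] at hlim
    refine hlim.congr' ?_
    filter_upwards [hmem] with y hy
    field_simp [(hO.pos y hy).ne', (hO.pos (c * y) (mul_pos hc hy)).ne']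

lemma RegVaryAtZero.tendsto_decayFInv_mul_div (hf : RegVaryAtZero f β) (hβ : 1 < β)
    (hO : IsOsgood f) {c : ℝ} (hc : 0 < c) :
    Tendsto (fun t => decayFInv f (c * t) / decayFInv f t) atTop (𝓝 (c ^ (1 - β)⁻¹)) := by
  have hβ' : 1 - β < 0 := sub_neg.2 hβ
  have hlim : ∀ κ > 0, Tendsto (fun t => decayF f (κ * decayFInv f t) / t) atTop
      (𝓝 (κ ^ (1 - β))) := fun κ hκ => by
    refine ((hf.tendsto_decayF_mul_div hO hκ).comp hO.tendsto_decayFInv).congr' ?_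
    filter_upwards [eventually_ge_atTop 0] with t ht
    rw [Function.comp_apply, hO.decayF_decayFInv ht]
  refine tendsto_order.2 ⟨fun a ha => ?_, fun b hb => ?_⟩
  · rcases le_or_gt a 0 with ha0 | ha0
    · filter_upwards [eventually_ge_atTop 0] with t ht
      exact ha0.trans_lt (div_pos (hO.decayFInv_pos (by positivity)) (hO.decayFInv_pos ht))
    · have hca : c < a ^ (1 - β) := (Real.lt_rpow_inv_iff_of_neg ha0 hc hβ').1 ha
      filter_upwards [(hlim a ha0).eventually_const_lt hca, eventually_gt_atTop 0] with t hct ht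
      have hinv := hO.decayFInv_pos ht.le
      rw [lt_div_iff₀ hinv, hO.lt_decayFInv_iff (by positivity) (by positivity)]
      exact (lt_div_iff₀ ht).1 hct
  · have hb0 : 0 < b := (Real.rpow_pos_of_pos hc _).trans hb
    have hbc : b ^ (1 - β) < c := (Real.rpow_inv_lt_iff_of_neg hc hb0 hβ').1 hb
    filter_upwards [(hlim b hb0).eventually_lt_const hbc, eventually_gt_atTop 0] with t hct ht
    have hinv := hO.decayFInv_pos ht.le
    rw [div_lt_iff₀ hinv, hO.decayFInv_lt_iff (by positivity) (by positivity)]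
    exact (div_lt_iff₀ ht).1 hct

lemma tendsto_nhdsGT_zero_of_tendsto_div {ι : Type*} {l : Filter ι} {u v : ι → ℝ} {μ : ℝ}
    (hμ : 0 < μ) (hv : Tendsto v l (𝓝[>] 0)) (huv : Tendsto (fun i => u i / v i) l (𝓝 μ)) :
    Tendsto u l (𝓝[>] 0) := by
  have hv_pos : ∀ᶠ i in l, 0 < v i := hv.eventually self_mem_nhdsWithin
  have hzero := huv.mul (tendsto_nhds_of_tendsto_nhdsWithin hv)
  rw [mul_zero] at hzero
  refine tendsto_nhdsWithin_iff.2 ⟨hzero.congr' ?_, ?_⟩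
  · filter_upwards [hv_pos] with i hvi using div_mul_cancel₀ _ hvi.ne'
  · filter_upwards [hv_pos, huv.eventually_const_lt hμ] with i hvi hui
    exact (div_pos_iff_of_pos_right hvi).1 hui

/-- Asymptotic monotonicity replaces the uniform convergence theorem for regularly varying
functions: `f (u i)` is compared with `f (κ * v i)` for a fixed `κ < μ` close to `μ`. -/
lemma RegVaryAtZero.eventually_lt_comp_div_comp (hf : RegVaryAtZero f β)
    (hmono : AsympIncreasingAtZero f) {ι : Type*} {l : Filter ι} {u v : ι → ℝ} {μ : ℝ}
    (hμ : 0 < μ) (hv : Tendsto v l (𝓝[>] 0)) (huv : Tendsto (fun i => u i / v i) l (𝓝 μ))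
    {a : ℝ} (ha : a < μ ^ β) : ∀ᶠ i in l, a < f (u i) / f (v i) := by
  have hpos : ∀ᶠ y in 𝓝[>] 0, 0 < f y := by filter_upwards [self_mem_nhdsWithin] using hf.2.1
  have hu := tendsto_nhdsGT_zero_of_tendsto_div hμ hv huv
  obtain ⟨s, hs, has⟩ : ∃ s > 1, s * a < (μ / s) ^ β := by
    refine Eventually.exists_gt (ContinuousAt.eventually_lt (by fun_prop) ?_ (by simpa using ha))
    exact (by fun_prop (disch := norm_num) : ContinuousAt (fun s : ℝ => μ / s) 1).rpow_const
      (.inl (by simpa using hμ.ne'))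
  have hκ : 0 < μ / s := by positivity
  filter_upwards [hv.eventually self_mem_nhdsWithin,
    huv.eventually_const_lt (div_lt_self hμ hs), ((hf.2.2 _ hκ).comp hv).eventually_const_lt has,
    hu.eventually (hmono.eventually_forall_le_mul hpos hs)] with i hvi hκu hsa hle
  rw [lt_div_iff₀ hvi] at hκu
  have hfv := hf.2.1 _ hvi
  rw [lt_div_iff₀ hfv]
  refine lt_of_mul_lt_mul_left ?_ (one_pos.trans hs).le
  calc s * (a * f (v i)) = s * a * f (v i) := (mul_assoc _ _ _).symm
    _ < f (μ / s * v i) := (lt_div_iff₀ hfv).1 hsa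
    _ ≤ s * f (u i) := hle _ ⟨mul_pos hκ hvi, hκu.le⟩

lemma RegVaryAtZero.tendsto_comp_div_comp (hf : RegVaryAtZero f β) (hmono : AsympIncreasingAtZero f)
    {ι : Type*} {l : Filter ι} {u v : ι → ℝ} {μ : ℝ} (hμ : 0 < μ) (hv : Tendsto v l (𝓝[>] 0))
    (huv : Tendsto (fun i => u i / v i) l (𝓝 μ)) :
    Tendsto (fun i => f (u i) / f (v i)) l (𝓝 (μ ^ β)) := by
  have hu := tendsto_nhdsGT_zero_of_tendsto_div hμ hv huv
  have hvu : Tendsto (fun i => v i / u i) l (𝓝 μ⁻¹) := by simpa only [inv_div] using huv.inv₀ hμ.ne'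
  refine tendsto_order.2
    ⟨fun a ha => hf.eventually_lt_comp_div_comp hmono hμ hv huv ha, fun b hb => ?_⟩
  have hμβ : 0 < μ ^ β := Real.rpow_pos_of_pos hμ β
  have hb_inv : b⁻¹ < μ⁻¹ ^ β := by
    rw [Real.inv_rpow hμ.le]
    exact inv_strictAnti₀ hμβ hb
  filter_upwards [hf.eventually_lt_comp_div_comp hmono (inv_pos.2 hμ) hu hvu hb_inv,
    hv.eventually self_mem_nhdsWithin, hu.eventually self_mem_nhdsWithin] with i hi hvi hui
  rwa [← inv_div, inv_lt_inv₀ (hμβ.trans hb) (div_pos (hf.2.1 _ hui) (hf.2.1 _ hvi))] at hi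

lemma RegVaryAtZero.regVaryAtInfty_comp_decayFInv (hf : RegVaryAtZero f β) (hβ : 1 < β)
    (hO : IsOsgood f) (hmono : AsympIncreasingAtZero f) :
    RegVaryAtInfty (f ∘ decayFInv f) (-(β / (β - 1))) := by
  refine ⟨hO.measurable_comp_decayFInv, fun t ht => hf.2.1 _ (hO.decayFInv_pos ht),
    fun c hc => ?_⟩
  have hexp : (c ^ (1 - β)⁻¹) ^ β = c ^ (-(β / (β - 1))) := by
    rw [← Real.rpow_mul hc.le, ← div_eq_inv_mul, ← neg_sub β 1, div_neg]
  rw [← hexp]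
  exact hf.tendsto_comp_div_comp hmono (Real.rpow_pos_of_pos hc _) hO.tendsto_decayFInv
    (hf.tendsto_decayFInv_mul_div hβ hO hc)

end RegularVariation

section TransformedEquation

variable {g h y : ℝ → ℝ} {c m α γ l Λ : ℝ}

lemma RegVaryAtInfty.tendsto_div_comp_mul (hh : RegVaryAtInfty h α) (hc : 0 < c) :
    Tendsto (fun t => h t / h (c * t)) atTop (𝓝 (c ^ (-α))) := by
  rw [Real.rpow_neg hc.le]
  simpa only [inv_div] using (hh.2.2 c hc).inv₀ (Real.rpow_pos_of_pos hc α).ne'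

lemma RegVaryAtInfty.div_mul_div_comp_mul_eventuallyEq (hh : RegVaryAtInfty h α) :
    (fun t => g t / h t * (h t / h (c * t))) =ᶠ[atTop] fun t => g t / h (c * t) := by
  filter_upwards [eventually_ge_atTop 0] with t ht
  exact div_mul_div_cancel₀ (hh.2.1 t ht).ne'

lemma eventually_le_line_of_le_div (hy : ∀ᶠ t in atTop, HasDerivAt y (1 - g t / h (y t)) t)
    (hg : ∀ᶠ t in atTop, 0 ≤ g t) (hh_pos : ∀ᶠ s in atTop, 0 < h s)
    (hh_anti : AlmostAntitoneAtTop h) (hc : 0 < c) (hcm : 1 - c < m)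
    (hm : ∀ᶠ t in atTop, m ≤ g t / h (c * t)) : ∀ᶠ t in atTop, y t ≤ c * t := by
  obtain ⟨K, hK1, hK⟩ : ∃ K > 1, 1 - c < m / K :=
    Eventually.exists_gt <| ContinuousAt.eventually_lt continuousAt_const
      (by fun_prop (disch := norm_num)) (by simpa using hcm)
  have hct : Tendsto (fun t => c * t) atTop atTop := tendsto_id.const_mul_atTop hc
  have hderiv : ∀ᶠ t in atTop, 0 ≤ y t - c * t →
      1 - g t / h (y t) - c * 1 ≤ -(m / K - (1 - c)) := by
    filter_upwards [hg, hm, hct.eventually (hh_anti K hK1),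
      hct.eventually_forall_ge_atTop hh_pos] with t hgt hmt hle hhy hyt
    rw [sub_nonneg] at hyt
    have hforcing : m / K ≤ g t / h (y t) :=
      calc m / K ≤ g t / h (c * t) / K := by gcongr
        _ = g t / (K * h (c * t)) := by rw [div_div, mul_comm]
        _ ≤ g t / h (y t) := div_le_div_of_nonneg_left hgt (hhy _ hyt) (hle _ hyt)
    linarith
  filter_upwards [eventually_nonpos_of_deriv_le_neg (sub_pos.2 hK)
    (hy.mono fun t ht => ht.sub ((hasDerivAt_id t).const_mul c)) hderiv] with t ht
  exact sub_nonpos.1 ht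

lemma eventually_line_le_of_div_le (hy : ∀ᶠ t in atTop, HasDerivAt y (1 - g t / h (y t)) t)
    (hy_top : Tendsto y atTop atTop) (hg : ∀ᶠ t in atTop, 0 ≤ g t)
    (hh_pos : ∀ᶠ s in atTop, 0 < h s) (hh_anti : AlmostAntitoneAtTop h) (hc : 0 < c)
    (hcm : m < 1 - c) (hm : ∀ᶠ t in atTop, g t / h (c * t) ≤ m) :
    ∀ᶠ t in atTop, c * t ≤ y t := by
  obtain ⟨K, hK1, hK⟩ : ∃ K > 1, K * m < 1 - c :=
    Eventually.exists_gt <| ContinuousAt.eventually_lt (by fun_prop) continuousAt_const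
      (by simpa using hcm)
  have hct : Tendsto (fun t => c * t) atTop atTop := tendsto_id.const_mul_atTop hc
  have hderiv : ∀ᶠ t in atTop, 0 ≤ c * t - y t →
      c * 1 - (1 - g t / h (y t)) ≤ -(1 - c - K * m) := by
    filter_upwards [hg, hm, hy_top.eventually (hh_anti K hK1), hct.eventually hh_pos]
      with t hgt hmt hle hhct hyt
    rw [sub_nonneg] at hyt
    have hforcing : g t / h (y t) ≤ K * m :=
      calc g t / h (y t) = K * (g t / (K * h (y t))) := by field_simp
        _ ≤ K * (g t / h (c * t)) := by gcongr; exact hle _ hyt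
        _ ≤ K * m := by gcongr
    linarith
  filter_upwards [eventually_nonpos_of_deriv_le_neg (sub_pos.2 hK)
    (hy.mono fun t ht => ((hasDerivAt_id t).const_mul c).sub ht) hderiv] with t ht
  exact sub_nonpos.1 ht

lemma RegVaryAtInfty.eventually_pos (hh : RegVaryAtInfty h α) : ∀ᶠ s in atTop, 0 < h s :=
  (eventually_ge_atTop 0).mono hh.2.1

lemma RegVaryAtInfty.tendsto_div_of_one_sub_eq (hh : RegVaryAtInfty h (-γ))
    (hh_anti : AlmostAntitoneAtTop h) (hg : ∀ᶠ t in atTop, 0 ≤ g t)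
    (hgl : Tendsto (fun t => g t / h t) atTop (𝓝 l))
    (hy : ∀ᶠ t in atTop, HasDerivAt y (1 - g t / h (y t)) t) (hy_top : Tendsto y atTop atTop)
    (hγ : 0 ≤ γ) (hΛ : 0 < Λ) (hroot : 1 - Λ = l * Λ ^ γ) :
    Tendsto (fun t => y t / t) atTop (𝓝 Λ) := by
  have hl : 0 ≤ l := ge_of_tendsto hgl <| by
    filter_upwards [hg, hh.eventually_pos] with t hgt hht using div_nonneg hgt hht.le
  have hlim : ∀ c > 0, Tendsto (fun t => g t / h (c * t)) atTop (𝓝 (l * c ^ γ)) := fun c hc => by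
    have hlim' := hgl.mul (hh.tendsto_div_comp_mul hc)
    rw [neg_neg] at hlim'
    exact hlim'.congr' hh.div_mul_div_comp_mul_eventuallyEq
  refine tendsto_div_of_eventually_between_lines (hy_top.eventually_ge_atTop 0)
    (fun c hc hcΛ => ?_) (fun c hΛc => ?_)
  · have hdrift : l * c ^ γ < 1 - c :=
      calc l * c ^ γ ≤ l * Λ ^ γ := by gcongr
        _ = 1 - Λ := hroot.symm
        _ < 1 - c := by gcongr
    obtain ⟨m, hlm, hmc⟩ := exists_between hdrift
    exact eventually_line_le_of_div_le hy hy_top hg hh.eventually_pos hh_anti hc hmc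
      ((hlim c hc).eventually_le_const hlm)
  · have hdrift : 1 - c < l * c ^ γ :=
      calc 1 - c < 1 - Λ := by gcongr
        _ = l * Λ ^ γ := hroot
        _ ≤ l * c ^ γ := by gcongr
    obtain ⟨m, hcm, hml⟩ := exists_between hdrift
    exact eventually_le_line_of_le_div hy hg hh.eventually_pos hh_anti (hΛ.trans hΛc) hcm
      ((hlim c (hΛ.trans hΛc)).eventually_const_le hml)

lemma RegVaryAtInfty.tendsto_div_zero_of_tendsto_atTop (hh : RegVaryAtInfty h α)
    (hh_anti : AlmostAntitoneAtTop h) (hgh : Tendsto (fun t => g t / h t) atTop atTop)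
    (hy : ∀ᶠ t in atTop, HasDerivAt y (1 - g t / h (y t)) t) (hy_nonneg : ∀ᶠ t in atTop, 0 ≤ y t) :
    Tendsto (fun t => y t / t) atTop (𝓝 0) := by
  have hg : ∀ᶠ t in atTop, 0 ≤ g t := by
    filter_upwards [hgh.eventually_ge_atTop 0, hh.eventually_pos] with t hght hht
    rwa [le_div_iff₀ hht, zero_mul] at hght
  refine tendsto_div_of_eventually_between_lines hy_nonneg
    (fun c hc hc0 => absurd hc0 hc.not_gt) (fun c hc => ?_)
  have hlim : Tendsto (fun t => g t / h (c * t)) atTop atTop :=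
    (hgh.atTop_mul_pos (Real.rpow_pos_of_pos hc _) (hh.tendsto_div_comp_mul hc)).congr'
      hh.div_mul_div_comp_mul_eventuallyEq
  exact eventually_le_line_of_le_div hy hg hh.eventually_pos hh_anti hc (sub_lt_self 1 hc)
    (hlim.eventually_ge_atTop 1)

end TransformedEquation

section RootEquation

variable {γ l Λ : ℝ}

lemma one_sub_mul_rpow_neg_eq_iff (hΛ : 0 < Λ) :
    (1 - Λ) * Λ ^ (-γ) = l ↔ 1 - Λ = l * Λ ^ γ := by
  rw [Real.rpow_neg hΛ.le, ← div_eq_mul_inv, div_eq_iff (Real.rpow_pos_of_pos hΛ γ).ne']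

lemma exists_unique_one_sub_mul_rpow_neg_eq (hγ : 0 < γ) (hl : 0 < l) :
    ∃ Λ ∈ Ioo (0 : ℝ) 1, (1 - Λ) * Λ ^ (-γ) = l ∧
      ∀ Λ' > 0, (1 - Λ') * Λ' ^ (-γ) = l → Λ' = Λ := by
  have hmono : StrictMonoOn (fun Λ : ℝ => Λ + l * Λ ^ γ) (Ici 0) :=
    strictMonoOn_id.add fun a ha b hb hab =>
      mul_lt_mul_of_pos_left (Real.strictMonoOn_rpow_Ici_of_exponent_pos hγ ha hb hab) hl
  have hcont : Continuous fun Λ : ℝ => Λ + l * Λ ^ γ := by fun_prop (disch := positivity)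
  obtain ⟨Λ, hΛ, hroot⟩ : (1 : ℝ) ∈ (fun Λ : ℝ => Λ + l * Λ ^ γ) '' Ioo 0 1 := by
    refine intermediate_value_Ioo zero_le_one hcont.continuousOn ?_
    simp [Real.zero_rpow hγ.ne', hl]
  have hiff : ∀ Λ' > 0, (1 - Λ') * Λ' ^ (-γ) = l ↔ Λ' + l * Λ' ^ γ = 1 := fun Λ' hΛ' => by
    rw [one_sub_mul_rpow_neg_eq_iff hΛ', sub_eq_iff_eq_add', eq_comm]
  refine ⟨Λ, hΛ, (hiff Λ hΛ.1).2 hroot, fun Λ' hΛ' hroot' => ?_⟩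
  exact hmono.injOn hΛ'.le hΛ.1.le (((hiff Λ' hΛ').1 hroot').trans hroot.symm)

end RootEquation

namespace IsPerturbedSolution

variable {f g x : ℝ → ℝ} {ξ α γ l s t Λ : ℝ}

lemma hasDerivAt_decayF_comp (hx : IsPerturbedSolution f g ξ x) (hO : IsOsgood f) (ht : 0 < t)
    (hxt : 0 < x t) : HasDerivAt (decayF f ∘ x) (1 - g t / f (x t)) t := by
  refine ((hO.hasDerivAt_decayF hxt).comp t (hx.hasDerivAt t ht)).congr_deriv ?_
  have hf := (hO.pos _ hxt).ne'
  field_simp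
  ring

lemma antitoneOn_decayF_comp_sub (hx : IsPerturbedSolution f g ξ x) (hO : IsOsgood f)
    (hg : ∀ t > 0, 0 ≤ g t) (hpos : ∀ t ∈ Ioo 0 s, 0 < x t) :
    AntitoneOn (fun t => decayF f (x t) - t) (Ioo 0 s) := by
  have hderiv : ∀ t ∈ Ioo 0 s,
      HasDerivAt (fun t => decayF f (x t) - t) (1 - g t / f (x t) - 1) t := fun t ht =>
    (hx.hasDerivAt_decayF_comp hO ht.1 (hpos t ht)).sub (hasDerivAt_id t)
  refine antitoneOn_of_hasDerivWithinAt_nonpos (f' := fun t => 1 - g t / f (x t) - 1)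
    (convex_Ioo 0 s) (fun t ht => (hderiv t ht).continuousAt.continuousWithinAt) ?_ ?_ <;>
    rw [interior_Ioo]
  · exact fun t ht => (hderiv t ht).hasDerivWithinAt
  · intro t ht
    have hforcing := div_nonneg (hg t ht.1) (hO.pos _ (hpos t ht)).le
    linarith

lemma pos (hx : IsPerturbedSolution f g ξ x) (hO : IsOsgood f) (hg : ∀ t > 0, 0 ≤ g t)
    (hξ : 0 < ξ) (ht : 0 ≤ t) : 0 < x t := by
  by_contra! hxt
  obtain ⟨s, hs, hxs, hpos⟩ := exists_first_zero ht (hx.continuousOn.mono Icc_subset_Ici_self)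
    (hx.init ▸ hξ) hxt
  have hanti := hx.antitoneOn_decayF_comp_sub hO hg fun u hu => hpos u (Ioo_subset_Ico_self hu)
  have hx_zero : Tendsto x (𝓝[<] s) (𝓝[>] 0) := by
    refine tendsto_nhdsWithin_iff.2 ⟨?_, ?_⟩
    · have hcont := (hx.hasDerivAt s hs.1).continuousAt.tendsto
      rw [hxs] at hcont
      exact hcont.mono_left nhdsWithin_le_nhds
    · filter_upwards [Ioo_mem_nhdsLT hs.1] with u hu using hpos u (Ioo_subset_Ico_self hu)
  obtain ⟨r, hr⟩ := nonempty_Ioo.2 hs.1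
  obtain ⟨u, hlarge, hru, hus⟩ := (((hO.tendsto_decayF.comp hx_zero).eventually_gt_atTop
    (decayF f (x r) - r + s)).and (Ioo_mem_nhdsLT hr.2)).exists
  have hle : decayF f (x u) - u ≤ decayF f (x r) - r := hanti hr ⟨hr.1.trans hru, hus⟩ hru.le
  rw [Function.comp_apply] at hlarge
  linarith

lemma tendsto_decayF_comp (hx : IsPerturbedSolution f g ξ x) (hO : IsOsgood f)
    (hg : ∀ t > 0, 0 ≤ g t) (hξ : 0 < ξ) (hx_lim : Tendsto x atTop (𝓝 0)) :
    Tendsto (decayF f ∘ x) atTop atTop := by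
  refine hO.tendsto_decayF.comp (tendsto_nhdsWithin_iff.2 ⟨hx_lim, ?_⟩)
  filter_upwards [eventually_ge_atTop 0] with t ht using hx.pos hO hg hξ ht

lemma eventually_hasDerivAt_decayF_comp (hx : IsPerturbedSolution f g ξ x) (hO : IsOsgood f)
    (hg : ∀ t > 0, 0 ≤ g t) (hξ : 0 < ξ) :
    ∀ᶠ t in atTop, HasDerivAt (decayF f ∘ x)
      (1 - g t / (f ∘ decayFInv f) ((decayF f ∘ x) t)) t := by
  filter_upwards [eventually_gt_atTop 0] with t ht
  have hxt := hx.pos hO hg hξ ht.le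
  rw [Function.comp_apply, Function.comp_apply, hO.decayFInv_decayF hxt]
  exact hx.hasDerivAt_decayF_comp hO ht hxt

lemma tendsto_decayF_div (hx : IsPerturbedSolution f g ξ x) (hO : IsOsgood f)
    (hg : ∀ t > 0, 0 ≤ g t) (hξ : 0 < ξ) (hf_mono : AsympIncreasingAtZero f)
    (hx_lim : Tendsto x atTop (𝓝 0)) (hh : RegVaryAtInfty (f ∘ decayFInv f) (-γ))
    (hgl : Tendsto (fun t => g t / f (decayFInv f t)) atTop (𝓝 l)) (hγ : 0 ≤ γ) (hΛ : 0 < Λ)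
    (hroot : (1 - Λ) * Λ ^ (-γ) = l) :
    Tendsto (fun t => decayF f (x t) / t) atTop (𝓝 Λ) :=
  hh.tendsto_div_of_one_sub_eq (hf_mono.almostAntitoneAtTop_comp_decayFInv hO)
    ((eventually_gt_atTop 0).mono hg) hgl (hx.eventually_hasDerivAt_decayF_comp hO hg hξ)
    (hx.tendsto_decayF_comp hO hg hξ hx_lim) hγ hΛ ((one_sub_mul_rpow_neg_eq_iff hΛ).1 hroot)

lemma tendsto_decayF_div_zero (hx : IsPerturbedSolution f g ξ x) (hO : IsOsgood f)
    (hg : ∀ t > 0, 0 ≤ g t) (hξ : 0 < ξ) (hf_mono : AsympIncreasingAtZero f)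
    (hx_lim : Tendsto x atTop (𝓝 0)) (hh : RegVaryAtInfty (f ∘ decayFInv f) α)
    (hg_top : Tendsto (fun t => g t / f (decayFInv f t)) atTop atTop) :
    Tendsto (fun t => decayF f (x t) / t) atTop (𝓝 0) :=
  hh.tendsto_div_zero_of_tendsto_atTop (hf_mono.almostAntitoneAtTop_comp_decayFInv hO) hg_top
    (hx.eventually_hasDerivAt_decayF_comp hO hg hξ)
    ((hx.tendsto_decayF_comp hO hg hξ hx_lim).eventually_ge_atTop 0)

end IsPerturbedSolution

theorem mainTheorem2_general (f g x : ℝ → ℝ) (ξ : ℝ) (L : EReal) (hf : IsOsgood f)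
    (hg : ∀ t > 0, 0 ≤ g t) (hξ : 0 < ξ)
    (hRV : (∃ β : ℝ, 1 < β ∧ RegVaryAtZero f β) ∨ RegVaryAtInfty (f ∘ decayFInv f) (-1))
    (hf_mono : AsympIncreasingAtZero f)
    (hx : IsPerturbedSolution f g ξ x)
    (hx_lim : Tendsto x atTop (𝓝 0))
    (hgL : Tendsto (fun t : ℝ => ((g t / f (decayFInv f t) : ℝ) : EReal)) atTop (𝓝 L)) :
    (L = 0 → Tendsto (fun t => decayF f (x t) / t) atTop (𝓝 1)) ∧
    (∀ l : ℝ, 0 < l → L = (l : EReal) →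
      (∀ β : ℝ, 1 < β → RegVaryAtZero f β →
        ∃ Λ ∈ Ioo (0 : ℝ) 1,
          (1 - Λ) * Λ ^ (-β / (β - 1)) = l ∧
          (∀ Λ' > 0, (1 - Λ') * Λ' ^ (-β / (β - 1)) = l → Λ' = Λ) ∧
          Tendsto (fun t => decayF f (x t) / t) atTop (𝓝 Λ)) ∧
      (RegVaryAtInfty (f ∘ decayFInv f) (-1) →
        1 / (1 + l) ∈ Ioo (0 : ℝ) 1 ∧
          Tendsto (fun t => decayF f (x t) / t) atTop (𝓝 (1 / (1 + l))))) ∧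
    (L = ⊤ → Tendsto (fun t => decayF f (x t) / t) atTop (𝓝 0)) := by
  have hconv {γ l Λ : ℝ} := hx.tendsto_decayF_div (γ := γ) (l := l) (Λ := Λ) hf hg hξ hf_mono hx_lim
  have hexp : ∀ β : ℝ, 1 < β → 0 < β / (β - 1) :=
    fun β hβ => div_pos (one_pos.trans hβ) (sub_pos.2 hβ)
  obtain ⟨γ, hγ, hh⟩ : ∃ γ > 0, RegVaryAtInfty (f ∘ decayFInv f) (-γ) := by
    rcases hRV with ⟨β, hβ, hfβ⟩ | hh
    · exact ⟨_, hexp β hβ, hfβ.regVaryAtInfty_comp_decayFInv hβ hf hf_mono⟩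
    · exact ⟨1, one_pos, hh⟩
  refine ⟨?_, fun l hl hLl => ?_, ?_⟩
  · rintro rfl
    exact hconv hh (EReal.tendsto_coe.1 hgL) hγ.le one_pos (by simp)
  · subst hLl
    have hgl := EReal.tendsto_coe.1 hgL
    refine ⟨fun β hβ hfβ => ?_, fun hh => ?_⟩
    · obtain ⟨Λ, hΛ, hroot, huniq⟩ := exists_unique_one_sub_mul_rpow_neg_eq (hexp β hβ) hl
      rw [neg_div]
      exact ⟨Λ, hΛ, hroot, huniq, hconv (hfβ.regVaryAtInfty_comp_decayFInv hβ hf hf_mono) hgl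
        (hexp β hβ).le hΛ.1 hroot⟩
    · have hΛ : 0 < 1 / (1 + l) := by positivity
      refine ⟨⟨hΛ, (div_lt_one (by positivity)).2 (by linarith)⟩, hconv hh hgl zero_le_one hΛ ?_⟩
      rw [Real.rpow_neg_one]
      field_simp
      ring
  · rintro rfl
    exact hx.tendsto_decayF_div_zero hf hg hξ hf_mono hx_lim hh
      (EReal.tendsto_coe_nhds_top_iff.1 hgL)

theorem mainTheorem2 (f g x : ℝ → ℝ) (ξ : ℝ) (L : EReal)
    (hf_sign : ∀ y : ℝ, y ≠ 0 → 0 < y * f y) (hf_zero : f 0 = 0)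
    (hf_lip : LocallyLipschitz f)
    (hg_cont : ContinuousOn g (Ici 0)) (hg_pos : ∀ t > 0, 0 < g t)
    (hξ : 0 < ξ)
    (hRV : (∃ β : ℝ, 1 < β ∧ RegVaryAtZero f β) ∨ RegVaryAtInfty (f ∘ decayFInv f) (-1))
    (hf_mono : AsympIncreasingAtZero f)
    (hx : IsPerturbedSolution f g ξ x)
    (hx_lim : Tendsto x atTop (𝓝 0))
    (hL : L ∈ Icc (0 : EReal) ⊤)
    (hgL : Tendsto (fun t : ℝ => ((g t / f (decayFInv f t) : ℝ) : EReal)) atTop (𝓝 L)) :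
    (L = 0 → Tendsto (fun t => decayF f (x t) / t) atTop (𝓝 1)) ∧
    (∀ l : ℝ, 0 < l → L = (l : EReal) →
      (∀ β : ℝ, 1 < β → RegVaryAtZero f β →
        ∃ Λ ∈ Ioo (0 : ℝ) 1,
          (1 - Λ) * Λ ^ (-β / (β - 1)) = l ∧
          (∀ Λ' > 0, (1 - Λ') * Λ' ^ (-β / (β - 1)) = l → Λ' = Λ) ∧
          Tendsto (fun t => decayF f (x t) / t) atTop (𝓝 Λ)) ∧
      (RegVaryAtInfty (f ∘ decayFInv f) (-1) →
        1 / (1 + l) ∈ Ioo (0 : ℝ) 1 ∧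
          Tendsto (fun t => decayF f (x t) / t) atTop (𝓝 (1 / (1 + l))))) ∧
    (L = ⊤ → Tendsto (fun t => decayF f (x t) / t) atTop (𝓝 0)) :=
  mainTheorem2_general f g x ξ L
    (.of_locallyLipschitz hf_lip hf_zero fun y hy => pos_of_mul_pos_right (hf_sign y hy.ne') hy.le)
    (fun t ht => (hg_pos t ht).le) hξ hRV hf_mono hx hx_lim hgL
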